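/- Let $\lambda,c,t>0$, let $p,q\ge 0$ with $p+q\le 1$, and let $\alpha\in\mathbb{R}$. A particle starts at the origin of the plane at time $0$ and moves with constant speed $c$ along one of the four directions $d_j=\left(\cos\frac{\pi j}{2},\sin\frac{\pi j}{2}\right)$, $j\in\mathbb{Z}/4\mathbb{Z}$. The initial direction is uniform on $\{d_0,d_1,d_2,d_3\}$. At the events of a homogeneous Poisson process of rate $\lambda$ (whose waiting times are independent and exponential with parameter $\lambda$) the direction changes: independently at each event, the current direction $d_j$ is replaced by $d_{j+1}$ with probability $p$ (counter-clockwise turn), by $d_{j-1}$ with probability $q$ (clockwise turn), and by $d_{j+2}$ with probability $1-p-q$ (reversal). The initial direction, the Poisson process and the turns are independent. Let $(X(t),Y(t))$ be the position of the particle at time $t$. **Theorem.** The bounded random variable $e^{i\alpha(X(t)-Y(t))}\,\mathbf 1_{\{X(t)+Y(t)=ct\}}$ is integrable. If $\lambda^2pq\neq\alpha^2c^2$, then $$\mathbb{E}\left[e^{i\alpha(X(t)-Y(t))}\,\mathbf 1_{\{X(t)+Y(t)=ct\}}\right]=\frac{e^{-\lambda t}}{4}\left[\left(1+\frac{\lambda(p+q)}{2\sqrt{\lambda^2pq-\alpha^2c^2}}\right)e^{t\sqrt{\lambda^2pq-\alpha^2c^2}}+\left(1-\frac{\lambda(p+q)}{2\sqrt{\lambda^2pq-\alpha^2c^2}}\right)e^{-t\sqrt{\lambda^2pq-\alpha^2c^2}}\right],$$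 where $\sqrt{\lambda^2pq-\alpha^2c^2}$ denotes either of the two complex square roots (the right-hand side does not depend on the choice). If $\lambda^2pq=\alpha^2c^2$, then the expectation equals the limiting value of this expression as the square root tends to $0$, namely $$\mathbb{E}\left[e^{i\alpha(X(t)-Y(t))}\,\mathbf 1_{\{X(t)+Y(t)=ct\}}\right]=\frac{e^{-\lambda t}}{4}\left[2+\lambda(p+q)t\right].$$ -/

import Mathlib

open MeasureTheory ProbabilityTheory

/-- The random ingredients of the planar motion with Poisson rate `lam` and turning probabilities
`p` (counter-clockwise), `q` (clockwise) and `1 - p - q` (reversal).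

Directions are labelled by `ZMod 4`: the label `j` stands for the unit vector
`d_j = (cos (π j / 2), sin (π j / 2))`.
* `D₀` is the initial direction, uniform on the four directions.
* `τ n` is the waiting time between the `n`-th and the `(n+1)`-st Poisson event (the `0`-th being
  the time origin); these are i.i.d. exponential with parameter `lam`.
* `ξ n` is the turn made at the `(n+1)`-st Poisson event; these are i.i.d., equal to `1` with
  probability `p`, to `-1` with probability `q` and to `2` with probability `1 - p - q`.

The initial direction, the waiting times and the turns are independent of each other. -/
structure IsMotionData {Ω : Type*} [MeasurableSpace Ω] (μ : Measure Ω) (lam p q : ℝ)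
    (D₀ : Ω → ZMod 4) (τ : ℕ → Ω → ℝ) (ξ : ℕ → Ω → ZMod 4) : Prop where
  measurable_init : Measurable D₀
  measurable_wait : ∀ n, Measurable (τ n)
  measurable_turn : ∀ n, Measurable (ξ n)
  prob_init : ∀ j : ZMod 4, μ {ω | D₀ ω = j} = 1 / 4
  law_wait : ∀ n, μ.map (τ n) = expMeasure lam
  prob_ccw : ∀ n, μ {ω | ξ n ω = 1} = ENNReal.ofReal p
  prob_cw : ∀ n, μ {ω | ξ n ω = -1} = ENNReal.ofReal q
  prob_reverse : ∀ n, μ {ω | ξ n ω = 2} = ENNReal.ofReal (1 - p - q)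
  indep_wait : iIndepFun τ μ
  indep_turn : iIndepFun ξ μ
  indep_wait_turn : IndepFun (fun ω n => τ n ω) (fun ω n => ξ n ω) μ
  indep_init : IndepFun D₀ (fun ω => ((fun n => τ n ω), (fun n => ξ n ω))) μ

/-- The time of the `n`-th Poisson event (`n ≥ 1`; the value at `n = 0` is `0`). -/
noncomputable def arrivalTime {Ω : Type*} (τ : ℕ → Ω → ℝ) (n : ℕ) (ω : Ω) : ℝ :=
  ∑ k ∈ Finset.range n, τ k ω

/-- `N(t)`: the number of Poisson events in `[0, t]`. -/
noncomputable def eventCount {Ω : Type*} (τ : ℕ → Ω → ℝ) (t : ℝ) (ω : Ω) : ℕ :=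
  Set.ncard {n : ℕ | 1 ≤ n ∧ arrivalTime τ n ω ≤ t}

/-- `D(t)`: the label of the direction at time `t`, that is the initial one changed by all the
turns made up to time `t`. -/
noncomputable def direction {Ω : Type*} (D₀ : Ω → ZMod 4) (τ : ℕ → Ω → ℝ) (ξ : ℕ → Ω → ZMod 4)
    (t : ℝ) (ω : Ω) : ZMod 4 :=
  D₀ ω + ∑ k ∈ Finset.range (eventCount τ t ω), ξ k ω

/-- `X(t)`: the abscissa of a particle that starts at the origin and moves with speed `c` in the
direction `d_{D(s)}` at each time `s`. -/
noncomputable def posX {Ω : Type*} (c : ℝ) (D₀ : Ω → ZMod 4) (τ : ℕ → Ω → ℝ)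
    (ξ : ℕ → Ω → ZMod 4) (t : ℝ) (ω : Ω) : ℝ :=
  ∫ s in (0 : ℝ)..t, c * Real.cos (Real.pi / 2 * ((direction D₀ τ ξ s ω).val : ℝ))

/-- `Y(t)`: the ordinate of that particle. -/
noncomputable def posY {Ω : Type*} (c : ℝ) (D₀ : Ω → ZMod 4) (τ : ℕ → Ω → ℝ)
    (ξ : ℕ → Ω → ZMod 4) (t : ℝ) (ω : Ω) : ℝ :=
  ∫ s in (0 : ℝ)..t, c * Real.sin (Real.pi / 2 * ((direction D₀ τ ξ s ω).val : ℝ))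

/-- The random variable `e^{iα(X(t) - Y(t))} 1{X(t) + Y(t) = ct}`. -/
noncomputable def sideExp {Ω : Type*} (c : ℝ) (D₀ : Ω → ZMod 4) (τ : ℕ → Ω → ℝ)
    (ξ : ℕ → Ω → ZMod 4) (α t : ℝ) : Ω → ℂ :=
  Set.indicator {ω | posX c D₀ τ ξ t ω + posY c D₀ τ ξ t ω = c * t}
    (fun ω => Complex.exp (Complex.I * ((α * (posX c D₀ τ ξ t ω - posY c D₀ τ ξ t ω) : ℝ) : ℂ)))

/-! The coordinate sum `X + Y` has velocity `c` along `d_0`, `d_1` and `-c` along `d_2`, `d_3`.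
Hence `X(t) + Y(t) = ct` exactly when only the labels `0` and `1` are used before time `t`, and the
particle can then only alternate between them: `0 → 1` with probability `p`, `1 → 0` with
probability `q`.

Conditioning on the first event gives renewal equations linking the contributions `f 0` and `f 1` of
the two starting labels (`integral_truncExp_succ`). Functions solving the corresponding linear
system `F' = (-λ + M) F`, `F(0) = (1, 1)`, solve these equations
(`isRenewalSolution_of_hasDerivAt`). Here `M` has rows `(iαc, λp)` and `(λq, -iαc)`, so `M² = (λ²pq
- α²c²) I`, and `e^{tM} = A I + B M` with scalar `A`, `B`.

To identify the expectation with this solution, paths are cut off after `n` steps (`truncExp`). The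
cut-off functional agrees with `sideExp` for large `n` (`sideExp_eq_truncExp`), while its
expectation converges geometrically to the renewal solution (`norm_integral_truncExp_sub_le`).
Averaging over the initial direction gives `(f 0 + f 1) / 4`. -/

open Filter Topology

/-! ### Deterministic paths: restarting the motion at the first event. -/

section Path

variable {Ω : Type*} {τ : ℕ → Ω → ℝ} {ω : Ω}

theorem arrivalTime_succ_eq_shift (τ : ℕ → Ω → ℝ) (n : ℕ) (ω : Ω) :
    arrivalTime τ (n + 1) ω = τ 0 ω + arrivalTime (fun k => τ (k + 1)) n ω := by
  simp [arrivalTime, Finset.sum_range_succ', add_comm]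

theorem le_arrivalTime (hpos : ∀ k, 0 < τ k ω) {n : ℕ} (hn : 1 ≤ n) :
    τ 0 ω ≤ arrivalTime τ n ω := by
  obtain ⟨m, rfl⟩ := Nat.exists_eq_add_of_le' hn
  rw [arrivalTime_succ_eq_shift]
  have : 0 ≤ arrivalTime (fun k => τ (k + 1)) m ω :=
    Finset.sum_nonneg fun k _ => (hpos (k + 1)).le
  linarith

theorem tendsto_arrivalTime_shift (hlim : Tendsto (fun n => arrivalTime τ n ω) atTop atTop) :
    Tendsto (fun n => arrivalTime (fun k => τ (k + 1)) n ω) atTop atTop := by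
  have h := tendsto_atTop_add_const_left atTop (-τ 0 ω) ((tendsto_add_atTop_iff_nat 1).2 hlim)
  refine h.congr fun n => ?_
  rw [arrivalTime_succ_eq_shift]; ring

theorem finite_setOf_arrivalTime_le (hlim : Tendsto (fun n => arrivalTime τ n ω) atTop atTop)
    (t : ℝ) : {n : ℕ | 1 ≤ n ∧ arrivalTime τ n ω ≤ t}.Finite := by
  obtain ⟨N, hN⟩ := (hlim.eventually_gt_atTop t).exists_forall_of_atTop
  refine (Set.finite_lt_nat N).subset fun n hn => ?_
  by_contra h
  exact absurd hn.2 (not_le.2 (hN n (not_lt.1 h)))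

theorem eventCount_of_lt (hpos : ∀ k, 0 < τ k ω) {t : ℝ} (ht : t < τ 0 ω) :
    eventCount τ t ω = 0 := by
  have : {n : ℕ | 1 ≤ n ∧ arrivalTime τ n ω ≤ t} = ∅ := by
    ext n
    simp only [Set.mem_ofPred_eq, Set.mem_empty_iff_false, iff_false, not_and, not_le]
    exact fun hn => ht.trans_le (le_arrivalTime hpos hn)
  rw [eventCount, this, Set.ncard_empty]

/-- The first event is counted separately and the later ones are reindexed by the successor map.
Divergence of the arrival times matters because `Set.ncard` is `0` on infinite sets. -/
theorem eventCount_of_le (hlim : Tendsto (fun n => arrivalTime τ n ω) atTop atTop)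
    {t : ℝ} (ht : τ 0 ω ≤ t) :
    eventCount τ t ω = eventCount (fun k => τ (k + 1)) (t - τ 0 ω) ω + 1 := by
  have : {n : ℕ | 1 ≤ n ∧ arrivalTime τ n ω ≤ t} =
      insert 1 (Nat.succ '' {n : ℕ | 1 ≤ n ∧
        arrivalTime (fun k => τ (k + 1)) n ω ≤ t - τ 0 ω}) := by
    ext n
    rcases n with _ | _ | n
    · simp
    · simp [arrivalTime, ht]
    · simp only [Set.mem_ofPred_eq, Set.mem_insert_iff, Set.mem_image, Nat.succ_eq_add_one,
        Nat.add_right_cancel_iff, exists_eq_right, arrivalTime_succ_eq_shift τ (n + 1)]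
      constructor
      · exact fun h => Or.inr ⟨by omega, by linarith [h.2]⟩
      · rintro (h | h)
        · omega
        · exact ⟨by omega, by linarith [h.2]⟩
  rw [eventCount, this, Set.ncard_insert_of_notMem (by simp)
    ((finite_setOf_arrivalTime_le (tendsto_arrivalTime_shift hlim) _).image _),
    Set.ncard_image_of_injective _ Nat.succ_injective, eventCount]

theorem measurable_eventCount_time (hlim : Tendsto (fun n => arrivalTime τ n ω) atTop atTop) :
    Measurable fun t => eventCount τ t ω := by
  refine Monotone.measurable fun s t hst => ?_
  exact Set.ncard_le_ncard (fun n hn => ⟨hn.1, hn.2.trans hst⟩) (finite_setOf_arrivalTime_le hlim t)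

variable {D₀ : Ω → ZMod 4} {ξ : ℕ → Ω → ZMod 4}

theorem direction_of_lt (hpos : ∀ k, 0 < τ k ω) {t : ℝ} (ht : t < τ 0 ω) :
    direction D₀ τ ξ t ω = D₀ ω := by
  simp [direction, eventCount_of_lt hpos ht]

theorem direction_of_le (hlim : Tendsto (fun n => arrivalTime τ n ω) atTop atTop)
    {t : ℝ} (ht : τ 0 ω ≤ t) :
    direction D₀ τ ξ t ω =
      direction (fun ω => D₀ ω + ξ 0 ω) (fun k => τ (k + 1)) (fun k => ξ (k + 1))
        (t - τ 0 ω) ω := by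
  simp only [direction, eventCount_of_le hlim ht, Finset.sum_range_succ']
  ring

theorem measurable_direction_time (hlim : Tendsto (fun n => arrivalTime τ n ω) atTop atTop) :
    Measurable fun t => direction D₀ τ ξ t ω := by
  have : Measurable fun n : ℕ => D₀ ω + ∑ k ∈ Finset.range n, ξ k ω := measurable_from_top
  exact this.comp (measurable_eventCount_time hlim)

theorem intervalIntegrable_direction (hlim : Tendsto (fun n => arrivalTime τ n ω) atTop atTop)
    (g : ZMod 4 → ℝ) (a b : ℝ) :
    IntervalIntegrable (fun s => g (direction D₀ τ ξ s ω)) volume a b := by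
  obtain ⟨C, hC⟩ : ∃ C, ∀ j, ‖g j‖ ≤ C := by
    obtain ⟨C, hC⟩ := (Set.finite_range fun j => ‖g j‖).bddAbove
    exact ⟨C, fun j => hC ⟨j, rfl⟩⟩
  have hm : Measurable fun s => g (direction D₀ τ ξ s ω) :=
    (measurable_from_top (f := g)).comp (measurable_direction_time hlim)
  exact (intervalIntegrable_const (c := C)).mono_fun hm.aestronglyMeasurable
    (ae_of_all _ fun s => by
      simpa using (hC _).trans (le_abs_self C))

theorem integral_direction_of_le_wait (hpos : ∀ k, 0 < τ k ω) (g : ZMod 4 → ℝ) {t : ℝ}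
    (ht : 0 ≤ t) (htτ : t ≤ τ 0 ω) :
    ∫ s in (0 : ℝ)..t, g (direction D₀ τ ξ s ω) = g (D₀ ω) * t := by
  have : ∫ s in (0 : ℝ)..t, g (direction D₀ τ ξ s ω) = ∫ s in (0 : ℝ)..t, g (D₀ ω) := by
    refine intervalIntegral.integral_congr_ae ?_
    -- The endpoint is discarded because for `t = τ 0 ω` the turn has already happened at `s = t`.
    filter_upwards [Measure.ae_ne volume t] with s hs hst
    rw [Set.uIoc_of_le ht] at hst
    rw [direction_of_lt hpos ((lt_of_le_of_ne hst.2 hs).trans_le htτ)]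
  rw [this]; simp [mul_comm]

theorem integral_direction_of_wait_le (hpos : ∀ k, 0 < τ k ω)
    (hlim : Tendsto (fun n => arrivalTime τ n ω) atTop atTop) (g : ZMod 4 → ℝ) {t : ℝ}
    (ht : τ 0 ω ≤ t) :
    ∫ s in (0 : ℝ)..t, g (direction D₀ τ ξ s ω) = g (D₀ ω) * τ 0 ω +
      ∫ s in (0 : ℝ)..(t - τ 0 ω), g (direction (fun ω => D₀ ω + ξ 0 ω) (fun k => τ (k + 1))
        (fun k => ξ (k + 1)) s ω) := by
  rw [← intervalIntegral.integral_add_adjacent_intervals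
    (intervalIntegrable_direction hlim g 0 (τ 0 ω)) (intervalIntegrable_direction hlim g (τ 0 ω) t),
    integral_direction_of_le_wait hpos g (hpos 0).le le_rfl]
  congr 1
  have h := intervalIntegral.integral_comp_sub_right (a := τ 0 ω) (b := t)
    (fun s => g (direction (fun ω => D₀ ω + ξ 0 ω) (fun k => τ (k + 1))
        (fun k => ξ (k + 1)) s ω)) (τ 0 ω)
  rw [sub_self] at h
  rw [← h]
  refine intervalIntegral.integral_congr fun s hs => ?_
  rw [Set.uIcc_of_le ht] at hs
  simp only [direction_of_le hlim hs.1]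

end Path


/-! ### Unit vectors and the truncated functional of a path. -/

/-- The abscissa of the unit vector with label `j`. -/
noncomputable def unitX (j : ZMod 4) : ℝ := Real.cos (Real.pi / 2 * (j.val : ℝ))

/-- The ordinate of the unit vector with label `j`. -/
noncomputable def unitY (j : ZMod 4) : ℝ := Real.sin (Real.pi / 2 * (j.val : ℝ))

theorem unitX_zero : unitX 0 = 1 := by simp [unitX]
theorem unitY_zero : unitY 0 = 0 := by simp [unitY]
theorem unitX_one : unitX 1 = 0 := by simp [unitX, show (1 : ZMod 4).val = 1 from rfl]
theorem unitY_one : unitY 1 = 1 := by simp [unitY, show (1 : ZMod 4).val = 1 from rfl]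
theorem unitX_two : unitX 2 = -1 := by
  simp [unitX, show (2 : ZMod 4).val = 2 from rfl]
theorem unitY_two : unitY 2 = 0 := by
  simp [unitY, show (2 : ZMod 4).val = 2 from rfl]
theorem three_mul_pi_div_two : Real.pi / 2 * 3 = Real.pi / 2 + Real.pi := by ring
theorem unitX_three : unitX 3 = 0 := by
  simp [unitX, show (3 : ZMod 4).val = 3 from rfl, three_mul_pi_div_two, Real.cos_add_pi]
theorem unitY_three : unitY 3 = -1 := by
  simp [unitY, show (3 : ZMod 4).val = 3 from rfl, three_mul_pi_div_two, Real.sin_add_pi]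

theorem zmod_four_cases (j : ZMod 4) : j = 0 ∨ j = 1 ∨ j = 2 ∨ j = 3 := by
  revert j; decide

theorem unitX_add_unitY_eq_one {j : ZMod 4} (hj : j = 0 ∨ j = 1) : unitX j + unitY j = 1 := by
  rcases hj with rfl | rfl <;> simp [unitX_zero, unitX_one, unitY_zero, unitY_one]

theorem unitX_add_unitY_eq_neg_one {j : ZMod 4} (hj : ¬(j = 0 ∨ j = 1)) :
    unitX j + unitY j = -1 := by
  rcases zmod_four_cases j with rfl | rfl | rfl | rfl
  · simp at hj
  · simp at hj
  · simp [unitX_two, unitY_two]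
  · simp [unitX_three, unitY_three]

theorem unitX_add_unitY_le (j : ZMod 4) : unitX j + unitY j ≤ 1 := by
  by_cases hj : j = 0 ∨ j = 1
  · exact (unitX_add_unitY_eq_one hj).le
  · rw [unitX_add_unitY_eq_neg_one hj]; norm_num

/-- The functional of the waiting times `x` and the turns `y` which is `e^{iα(X(t)-Y(t))}` for a
path that starts with label `j`, uses only the labels `0` and `1` and makes less than `n` turns
before time `t`, and `0` for all other paths. -/
noncomputable def truncExp (c α : ℝ) : ℕ → ZMod 4 → ℝ → (ℕ → ℝ) → (ℕ → ZMod 4) → ℂ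
  | 0, _, _, _, _ => 0
  | n + 1, j, t, x, y =>
    if j = 0 ∨ j = 1 then
      if t ≤ x 0 then Complex.exp (Complex.I * ((α * (c * (unitX j - unitY j) * t) : ℝ) : ℂ))
      else Complex.exp (Complex.I * ((α * (c * (unitX j - unitY j) * x 0) : ℝ) : ℂ)) *
        truncExp c α n (j + y 0) (t - x 0) (fun k => x (k + 1)) (fun k => y (k + 1))
    else 0

section Pos

variable {Ω : Type*} {τ : ℕ → Ω → ℝ} {ω : Ω} {D₀ : Ω → ZMod 4} {ξ : ℕ → Ω → ZMod 4} (c : ℝ)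

theorem posX_of_le_wait (hpos : ∀ k, 0 < τ k ω) {t : ℝ} (ht : 0 ≤ t) (htτ : t ≤ τ 0 ω) :
    posX c D₀ τ ξ t ω = c * unitX (D₀ ω) * t :=
  integral_direction_of_le_wait hpos (fun j => c * unitX j) ht htτ

theorem posY_of_le_wait (hpos : ∀ k, 0 < τ k ω) {t : ℝ} (ht : 0 ≤ t) (htτ : t ≤ τ 0 ω) :
    posY c D₀ τ ξ t ω = c * unitY (D₀ ω) * t :=
  integral_direction_of_le_wait hpos (fun j => c * unitY j) ht htτ

theorem posX_of_wait_le (hpos : ∀ k, 0 < τ k ω)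
    (hlim : Tendsto (fun n => arrivalTime τ n ω) atTop atTop) {t : ℝ} (ht : τ 0 ω ≤ t) :
    posX c D₀ τ ξ t ω = c * unitX (D₀ ω) * τ 0 ω +
      posX c (fun ω => D₀ ω + ξ 0 ω) (fun k => τ (k + 1)) (fun k => ξ (k + 1)) (t - τ 0 ω) ω :=
  integral_direction_of_wait_le hpos hlim (fun j => c * unitX j) ht

theorem posY_of_wait_le (hpos : ∀ k, 0 < τ k ω)
    (hlim : Tendsto (fun n => arrivalTime τ n ω) atTop atTop) {t : ℝ} (ht : τ 0 ω ≤ t) :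
    posY c D₀ τ ξ t ω = c * unitY (D₀ ω) * τ 0 ω +
      posY c (fun ω => D₀ ω + ξ 0 ω) (fun k => τ (k + 1)) (fun k => ξ (k + 1)) (t - τ 0 ω) ω :=
  integral_direction_of_wait_le hpos hlim (fun j => c * unitY j) ht

variable {c} in
theorem posX_add_posY_le (hc : 0 < c)
    (hlim : Tendsto (fun n => arrivalTime τ n ω) atTop atTop) {t : ℝ} (ht : 0 ≤ t) :
    posX c D₀ τ ξ t ω + posY c D₀ τ ξ t ω ≤ c * t := by
  have hX := intervalIntegrable_direction (D₀ := D₀) (ξ := ξ) hlim (fun j => c * unitX j) 0 t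
  have hY := intervalIntegrable_direction (D₀ := D₀) (ξ := ξ) hlim (fun j => c * unitY j) 0 t
  have h := intervalIntegral.integral_add hX hY
  have h' : posX c D₀ τ ξ t ω + posY c D₀ τ ξ t ω =
      ∫ s in (0 : ℝ)..t, (c * unitX (direction D₀ τ ξ s ω) + c * unitY (direction D₀ τ ξ s ω)) :=
    h.symm
  rw [h']
  have := intervalIntegral.integral_mono ht (hX.add hY) (intervalIntegrable_const (c := c))
    (fun s => by
      have := unitX_add_unitY_le (direction D₀ τ ξ s ω)
      simp only
      nlinarith)
  simpa [mul_comm] using this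

variable {c} in
-- Induction on the first event. A first label outside `{0, 1}` makes `X + Y` lose `2c · τ 0`
-- against its maximal growth, and `posX_add_posY_le` shows that the rest of the path cannot make up
-- for it.
theorem sideExp_eq_truncExp (hc : 0 < c) (α : ℝ) (n : ℕ) {t : ℝ} (ht : 0 < t)
    (hpos : ∀ k, 0 < τ k ω) (hlim : Tendsto (fun n => arrivalTime τ n ω) atTop atTop)
    (htn : t ≤ arrivalTime τ n ω) :
    sideExp c D₀ τ ξ α t ω =
      truncExp c α n (D₀ ω) t (fun k => τ k ω) (fun k => ξ k ω) := by
  induction n generalizing t D₀ τ ξ with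
  -- The arrival time of index `0` is `0`, which contradicts `0 < t`.
  | zero => simp [arrivalTime] at htn; linarith
  | succ n ih =>
    rw [truncExp]
    rcases le_or_gt t (τ 0 ω) with h0 | h0
    · simp only [sideExp, Set.indicator, Set.mem_ofPred_eq, posX_of_le_wait c hpos ht.le h0,
        posY_of_le_wait c hpos ht.le h0, if_pos h0]
      by_cases hj : D₀ ω = 0 ∨ D₀ ω = 1
      · have := unitX_add_unitY_eq_one hj
        rw [if_pos (by linear_combination c * t * this), if_pos hj]
        congr 4; ring
      · have := unitX_add_unitY_eq_neg_one hj
        have h1 : 0 < c * t := mul_pos hc ht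
        rw [if_neg (fun h => by
          have h2 : c * t * (unitX (D₀ ω) + unitY (D₀ ω)) = c * t := by linear_combination h
          rw [this] at h2; linarith), if_neg hj]
    · have hpos' : ∀ k, 0 < τ (k + 1) ω := fun k => hpos _
      have hlim' := tendsto_arrivalTime_shift hlim
      have ih' := ih (D₀ := fun ω => D₀ ω + ξ 0 ω) (τ := fun k => τ (k + 1))
        (ξ := fun k => ξ (k + 1)) (t := t - τ 0 ω) (by linarith) hpos' hlim' (by
          rw [arrivalTime_succ_eq_shift] at htn; linarith)
      have hle := posX_add_posY_le (D₀ := fun ω => D₀ ω + ξ 0 ω) (τ := fun k => τ (k + 1))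
        (ξ := fun k => ξ (k + 1)) hc hlim' (t := t - τ 0 ω) (by linarith)
      rw [if_neg (not_le.2 h0), ← ih']
      simp only [sideExp, Set.indicator, Set.mem_ofPred_eq, posX_of_wait_le c hpos hlim h0.le,
        posY_of_wait_le c hpos hlim h0.le]
      set x := posX c (fun ω => D₀ ω + ξ 0 ω) (fun k => τ (k + 1)) (fun k => ξ (k + 1))
        (t - τ 0 ω) ω
      set y := posY c (fun ω => D₀ ω + ξ 0 ω) (fun k => τ (k + 1)) (fun k => ξ (k + 1))
        (t - τ 0 ω) ω
      by_cases hj : D₀ ω = 0 ∨ D₀ ω = 1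
      · have := unitX_add_unitY_eq_one hj
        rw [if_pos hj]
        have e : (c * unitX (D₀ ω) * τ 0 ω + x + (c * unitY (D₀ ω) * τ 0 ω + y) = c * t) ↔
            x + y = c * (t - τ 0 ω) := by
          constructor <;> intro h
          · linear_combination h - c * τ 0 ω * this
          · linear_combination h + c * τ 0 ω * this
        simp only [e]
        split_ifs
        · rw [← Complex.exp_add]; congr 1; push_cast; ring
        · simp
      · have := unitX_add_unitY_eq_neg_one hj
        rw [if_neg hj, if_neg]
        intro h
        have h1 := mul_pos hc (hpos 0)
        have h2 : c * τ 0 ω * (unitX (D₀ ω) + unitY (D₀ ω)) + (x + y) = c * t := by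
          linear_combination h
        rw [this] at h2
        nlinarith

end Pos

theorem norm_truncExp_le (c α : ℝ) (n : ℕ) (j : ZMod 4) (t : ℝ) (x : ℕ → ℝ) (y : ℕ → ZMod 4) :
    ‖truncExp c α n j t x y‖ ≤ 1 := by
  induction n generalizing j t x y with
  | zero => simp [truncExp]
  | succ n ih =>
    rw [truncExp]
    split_ifs
    · rw [mul_comm Complex.I, Complex.norm_exp_ofReal_mul_I]
    · rw [norm_mul, mul_comm Complex.I, Complex.norm_exp_ofReal_mul_I, one_mul]
      exact ih ..
    · simp

theorem measurable_truncExp (c α : ℝ) (n : ℕ) :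
    Measurable fun z : ZMod 4 × ℝ × (ℕ → ℝ) × (ℕ → ZMod 4) =>
      truncExp c α n z.1 z.2.1 z.2.2.1 z.2.2.2 := by
  induction n with
  | zero => simp only [truncExp]; exact measurable_const
  | succ n ih =>
    simp only [truncExp]
    have hj : Measurable fun z : ZMod 4 × ℝ × (ℕ → ℝ) × (ℕ → ZMod 4) => z.1 + z.2.2.2 0 :=
      (Measurable.of_discrete (f := fun a : ZMod 4 × ZMod 4 => a.1 + a.2)).comp
        (Measurable.prodMk (f := fun z : ZMod 4 × ℝ × (ℕ → ℝ) × (ℕ → ZMod 4) => z.1)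
          (g := fun z => z.2.2.2 0) measurable_fst (by fun_prop))
    refine Measurable.ite ?_ (Measurable.ite (measurableSet_le (by fun_prop) (by fun_prop))
      (by fun_prop) (Measurable.mul (by fun_prop) ?_)) measurable_const
    · exact measurable_fst (MeasurableSet.of_discrete (s := {j : ZMod 4 | j = 0 ∨ j = 1}))
    · exact ih.comp (f := fun z : ZMod 4 × ℝ × (ℕ → ℝ) × (ℕ → ZMod 4) =>
        (z.1 + z.2.2.2 0, z.2.1 - z.2.2.1 0, (fun k => z.2.2.1 (k + 1)), fun k => z.2.2.2 (k + 1)))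
        (hj.prodMk (by fun_prop))

/-! ### Splitting off the first variable, and integration over independent variables. -/

section Independence

variable {Ω : Type*} [MeasurableSpace Ω] {μ : Measure Ω}

theorem indepFun_zero_tail {β : Type*} [MeasurableSpace β] {f : ℕ → Ω → β} (h : iIndepFun f μ)
    (hf : ∀ n, Measurable (f n)) : IndepFun (f 0) (fun ω n => f (n + 1) ω) μ := by
  have h1 := indep_iSup_of_disjoint (fun n => (hf n).comap_le)
    ((iIndepFun_iff_iIndep _ _ _).1 h) (S := {0}) (T := {n | 0 < n}) (by simp)
  rw [IndepFun_iff_Indep]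
  refine indep_of_indep_of_le_left (indep_of_indep_of_le_right h1 ?_) (by simp)
  rw [MeasurableSpace.pi, MeasurableSpace.comap_iSup]
  refine iSup_le fun n => ?_
  rw [MeasurableSpace.comap_comp]
  exact le_iSup₂_of_le (n + 1) (Nat.succ_pos n) le_rfl

/-- The joint law is `(A ⊗ B) ⊗ E`; reassociating the product measure gives `A ⊗ (B ⊗ E)`. -/
theorem IndepFun.prodMk_of_prodMk {α β γ : Type*} [MeasurableSpace α] [MeasurableSpace β]
    [MeasurableSpace γ] [IsProbabilityMeasure μ] {A : Ω → α} {B : Ω → β} {E : Ω → γ}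
    (hA : Measurable A) (hB : Measurable B) (hE : Measurable E)
    (hAB : IndepFun A B μ) (h : IndepFun (fun ω => (A ω, B ω)) E μ) :
    IndepFun A (fun ω => (B ω, E ω)) μ := by
  have hBE : IndepFun B E μ := h.comp measurable_snd measurable_id
  rw [indepFun_iff_map_prod_eq_prod_map_map (by fun_prop) (by fun_prop)] at *
  have := Measure.isProbabilityMeasure_map (μ := μ) hA.aemeasurable
  have := Measure.isProbabilityMeasure_map (μ := μ) hB.aemeasurable
  have := Measure.isProbabilityMeasure_map (μ := μ) hE.aemeasurable
  rw [hBE, ← Measure.prodAssoc_prod, ← hAB, ← h, Measure.map_map (by fun_prop) (by fun_prop)]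
  rfl

theorem integral_comp_of_indepFun [IsProbabilityMeasure μ] {α β : Type*} [MeasurableSpace α]
    [MeasurableSpace β] {X : Ω → α} {Y : Ω → β} (hX : Measurable X) (hY : Measurable Y)
    (h : IndepFun X Y μ) {G : α × β → ℂ} (hG : Measurable G) {C : ℝ} (hC : ∀ z, ‖G z‖ ≤ C) :
    ∫ ω, G (X ω, Y ω) ∂μ = ∫ x, ∫ ω, G (x, Y ω) ∂μ ∂(μ.map X) := by
  have := Measure.isProbabilityMeasure_map (μ := μ) hX.aemeasurable
  have := Measure.isProbabilityMeasure_map (μ := μ) hY.aemeasurable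
  rw [← integral_map (φ := fun ω => (X ω, Y ω)) (by fun_prop) hG.aestronglyMeasurable,
    (indepFun_iff_map_prod_eq_prod_map_map (by fun_prop) (by fun_prop)).1 h,
    integral_prod _ (Integrable.of_bound hG.aestronglyMeasurable C (ae_of_all _ hC))]
  refine integral_congr_ae (ae_of_all _ fun x => ?_)
  exact integral_map (by fun_prop) (hG.comp (by fun_prop)).aestronglyMeasurable

theorem integral_comp_of_indepFun_fintype [IsProbabilityMeasure μ] {α β : Type*}
    [MeasurableSpace α] [Fintype α] [MeasurableSingletonClass α]
    [MeasurableSpace β] {X : Ω → α} {Y : Ω → β} (hX : Measurable X) (hY : Measurable Y)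
    (h : IndepFun X Y μ) {G : α × β → ℂ} (hG : Measurable G) {C : ℝ} (hC : ∀ z, ‖G z‖ ≤ C) :
    ∫ ω, G (X ω, Y ω) ∂μ = ∑ a, μ.real {ω | X ω = a} • ∫ ω, G (a, Y ω) ∂μ := by
  have := Measure.isProbabilityMeasure_map (μ := μ) hX.aemeasurable
  rw [integral_comp_of_indepFun hX hY h hG hC, integral_fintype Integrable.of_finite]
  refine Finset.sum_congr rfl fun a _ => ?_
  rw [map_measureReal_apply hX (measurableSet_singleton a)]
  rfl

end Independence

/-- The waiting times and the turns of `IsMotionData`, without the initial direction. -/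
structure IsNoise {Ω : Type*} [MeasurableSpace Ω] (μ : Measure Ω) (lam p q : ℝ)
    (τ : ℕ → Ω → ℝ) (ξ : ℕ → Ω → ZMod 4) : Prop where
  measurable_wait : ∀ n, Measurable (τ n)
  measurable_turn : ∀ n, Measurable (ξ n)
  law_wait : ∀ n, μ.map (τ n) = expMeasure lam
  prob_ccw : ∀ n, μ {ω | ξ n ω = 1} = ENNReal.ofReal p
  prob_cw : ∀ n, μ {ω | ξ n ω = -1} = ENNReal.ofReal q
  prob_reverse : ∀ n, μ {ω | ξ n ω = 2} = ENNReal.ofReal (1 - p - q)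
  indep_wait : iIndepFun τ μ
  indep_turn : iIndepFun ξ μ
  indep_wait_turn : IndepFun (fun ω n => τ n ω) (fun ω n => ξ n ω) μ

/-! ### Almost sure properties of the waiting times and turns. -/

section Noise

variable {Ω : Type*} [MeasurableSpace Ω] {μ : Measure Ω} {lam p q : ℝ}
  {τ : ℕ → Ω → ℝ} {ξ : ℕ → Ω → ZMod 4}

theorem IsMotionData.isNoise {D₀ : Ω → ZMod 4} (h : IsMotionData μ lam p q D₀ τ ξ) :
    IsNoise μ lam p q τ ξ where
  measurable_wait := h.measurable_wait
  measurable_turn := h.measurable_turn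
  law_wait := h.law_wait
  prob_ccw := h.prob_ccw
  prob_cw := h.prob_cw
  prob_reverse := h.prob_reverse
  indep_wait := h.indep_wait
  indep_turn := h.indep_turn
  indep_wait_turn := h.indep_wait_turn

namespace IsNoise

/-- After the first event the motion continues with the shifted sequences from some new label; the
inductions therefore fix the starting label and use only the noise. -/
theorem shift (h : IsNoise μ lam p q τ ξ) :
    IsNoise μ lam p q (fun n => τ (n + 1)) (fun n => ξ (n + 1)) where
  measurable_wait n := h.measurable_wait _
  measurable_turn n := h.measurable_turn _
  law_wait n := h.law_wait _
  prob_ccw n := h.prob_ccw _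
  prob_cw n := h.prob_cw _
  prob_reverse n := h.prob_reverse _
  indep_wait := h.indep_wait.precomp (g := Nat.succ) Nat.succ_injective
  indep_turn := h.indep_turn.precomp (g := Nat.succ) Nat.succ_injective
  indep_wait_turn := h.indep_wait_turn.comp (φ := fun (x : ℕ → ℝ) n => x (n + 1))
    (ψ := fun (x : ℕ → ZMod 4) n => x (n + 1)) (by fun_prop) (by fun_prop)

theorem ae_wait_pos (h : IsNoise μ lam p q τ ξ) (hlam : 0 < lam) :
    ∀ᵐ ω ∂μ, ∀ k, 0 < τ k ω := by
  rw [ae_all_iff]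
  intro k
  have := isProbabilityMeasure_expMeasure hlam
  have h1 : expMeasure lam (Set.Iic 0) = 0 := by
    have := cdf_expMeasure_eq hlam 0
    simp only [le_refl, if_true, mul_zero, neg_zero, Real.exp_zero, sub_self] at this
    rwa [cdf_eq_real, measureReal_eq_zero_iff] at this
  rw [← h.law_wait k, Measure.map_apply (h.measurable_wait k) measurableSet_Iic] at h1
  rw [ae_iff]
  convert h1 using 2
  ext ω; simp

variable [IsProbabilityMeasure μ]

theorem indep_zero_wait (h : IsNoise μ lam p q τ ξ) :
    IndepFun (τ 0) (fun ω => (ξ 0 ω, (fun n => τ (n + 1) ω), fun n => ξ (n + 1) ω)) μ := by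
  have hτ := h.measurable_wait
  have hξ := h.measurable_turn
  have h1 : IndepFun (fun ω => (τ 0 ω, fun n => τ (n + 1) ω)) (fun ω n => ξ n ω) μ :=
    h.indep_wait_turn.comp (φ := fun x => (x 0, fun n => x (n + 1))) (ψ := id)
      (by fun_prop) measurable_id
  have h2 := IndepFun.prodMk_of_prodMk (hτ 0) (by fun_prop) (by fun_prop)
    (indepFun_zero_tail h.indep_wait hτ) h1
  exact h2.comp (φ := id) (ψ := fun z => (z.2 0, z.1, fun n => z.2 (n + 1))) measurable_id
    (by fun_prop)

theorem indep_zero_turn (h : IsNoise μ lam p q τ ξ) :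
    IndepFun (ξ 0) (fun ω => ((fun n => τ (n + 1) ω), fun n => ξ (n + 1) ω)) μ := by
  have hτ := h.measurable_wait
  have hξ := h.measurable_turn
  have h1 : IndepFun (fun ω => (ξ 0 ω, fun n => ξ (n + 1) ω)) (fun ω n => τ (n + 1) ω) μ :=
    h.indep_wait_turn.symm.comp (φ := fun x => (x 0, fun n => x (n + 1)))
      (ψ := fun x n => x (n + 1)) (by fun_prop) (by fun_prop)
  have h2 := IndepFun.prodMk_of_prodMk (hξ 0) (by fun_prop) (by fun_prop)
    (indepFun_zero_tail h.indep_turn hξ) h1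
  exact h2.comp (φ := id) (ψ := Prod.swap) measurable_id measurable_swap

/-- The three prescribed probabilities already add up to `1`. -/
theorem prob_zero_turn_eq_zero (h : IsNoise μ lam p q τ ξ) (hp : 0 ≤ p) (hq : 0 ≤ q)
    (hpq : p + q ≤ 1) : μ.real {ω | ξ 0 ω = 0} = 0 := by
  -- Integrating the constant `1` shows that the probabilities of the four values add up to `1`.
  have e := integral_comp_of_indepFun_fintype (μ := μ) (h.measurable_turn 0)
    (measurable_const (a := ())) (indepFun_const_right _ _) (G := fun _ => 1)
    measurable_const (C := 1) (by simp)
  have hsum : ∑ a : ZMod 4, μ.real {ω | ξ 0 ω = a} = 1 := by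
    have := congrArg Complex.re e
    simpa using this.symm
  have h1 : μ.real {ω | ξ 0 ω = 1} = p := by
    rw [Measure.real, h.prob_ccw, ENNReal.toReal_ofReal hp]
  have h2 : μ.real {ω | ξ 0 ω = 3} = q := by
    rw [show (3 : ZMod 4) = -1 by decide, Measure.real, h.prob_cw, ENNReal.toReal_ofReal hq]
  have h3 : μ.real {ω | ξ 0 ω = 2} = 1 - p - q := by
    rw [Measure.real, h.prob_reverse, ENNReal.toReal_ofReal (by linarith)]
  have h4 : ∑ a : ZMod 4, μ.real {ω | ξ 0 ω = a} = μ.real {ω | ξ 0 ω = 0} +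
      μ.real {ω | ξ 0 ω = 1} + μ.real {ω | ξ 0 ω = 2} + μ.real {ω | ξ 0 ω = 3} :=
    Fin.sum_univ_four (fun a : ZMod 4 => μ.real {ω | ξ 0 ω = a})
  linarith

/-- By the second Borel–Cantelli lemma, infinitely many of the independent, equally likely events `τ
n > 1` occur, so the positive series of waiting times diverges. -/
theorem ae_tendsto_arrivalTime (h : IsNoise μ lam p q τ ξ) (hlam : 0 < lam) :
    ∀ᵐ ω ∂μ, Tendsto (fun n => arrivalTime τ n ω) atTop atTop := by
  have hP := isProbabilityMeasure_expMeasure hlam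
  have hm : ∀ n, MeasurableSet (τ n ⁻¹' Set.Ioi 1) := fun n => h.measurable_wait n measurableSet_Ioi
  have hind : iIndepSet (fun n => τ n ⁻¹' Set.Ioi 1) μ := by
    rw [iIndepSet_iff_meas_biInter hm]
    intro s
    exact h.indep_wait.measure_inter_preimage_eq_mul s fun _ _ => measurableSet_Ioi
  have h1 : expMeasure lam (Set.Ioi 1) ≠ 0 := by
    intro h0
    have h2 : (expMeasure lam).real (Set.Iic 1) = 1 := by
      have := probReal_compl_eq_one_sub (μ := expMeasure lam) (measurableSet_Ioi (a := (1 : ℝ)))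
      rwa [Set.compl_Ioi, Measure.real_def _ (Set.Ioi 1), h0, ENNReal.toReal_zero, sub_zero] at this
    rw [← cdf_eq_real, cdf_expMeasure_eq hlam, if_pos zero_le_one] at h2
    linarith [Real.exp_pos (-(lam * 1))]
  have hlimsup := measure_limsup_eq_one hm hind (by
    have : ∀ n, μ (τ n ⁻¹' Set.Ioi 1) = expMeasure lam (Set.Ioi 1) := fun n => by
      rw [← h.law_wait n, Measure.map_apply (h.measurable_wait n) measurableSet_Ioi]
    simp only [this]
    exact ENNReal.tsum_const_eq_top_of_ne_zero h1)
  have hio : ∀ᵐ ω ∂μ, ω ∈ limsup (fun n => τ n ⁻¹' Set.Ioi 1) atTop :=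
    (prob_compl_eq_zero_iff (MeasurableSet.measurableSet_limsup hm)).2 hlimsup
  filter_upwards [hio, h.ae_wait_pos hlam] with ω hω hpos
  rw [mem_limsup_iff_frequently_mem] at hω
  refine (not_summable_iff_tendsto_nat_atTop_of_nonneg fun n => (hpos n).le).1 fun hs => ?_
  have := hs.tendsto_atTop_zero.eventually_lt_const one_pos
  obtain ⟨n, hn1, hn2⟩ := (hω.and_eventually this).exists
  exact absurd hn2 (not_lt.2 (le_of_lt hn1))

end IsNoise

end Noise

/-! ### The renewal equations and the convergence of the truncated expectations. -/

/-- The phase `e^{iα(X(u)-Y(u))}` of a particle that keeps the direction with label `j`. -/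
noncomputable def phase (c α : ℝ) (j : ZMod 4) (u : ℝ) : ℂ :=
  Complex.exp (Complex.I * ((α * (c * (unitX j - unitY j) * u) : ℝ) : ℂ))

theorem norm_phase (c α : ℝ) (j : ZMod 4) (u : ℝ) : ‖phase c α j u‖ = 1 := by
  rw [phase, mul_comm Complex.I, Complex.norm_exp_ofReal_mul_I]

@[fun_prop]
theorem continuous_phase (c α : ℝ) (j : ZMod 4) : Continuous (phase c α j) := by
  unfold phase; fun_prop

/-- The probability that a turn leads from the label `j ∈ {0, 1}` to the label `1 - j`. -/
noncomputable def swapProb (p q : ℝ) (j : ZMod 4) : ℝ := if j = 0 then p else q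

theorem swapProb_zero (p q : ℝ) : swapProb p q 0 = p := if_pos rfl

theorem swapProb_one (p q : ℝ) : swapProb p q 1 = q := if_neg (by decide)

theorem truncExp_succ (c α : ℝ) (n : ℕ) {j : ZMod 4} (hj : j = 0 ∨ j = 1) (t : ℝ) (x : ℕ → ℝ)
    (y : ℕ → ZMod 4) :
    truncExp c α (n + 1) j t x y = if t ≤ x 0 then phase c α j t else phase c α j (x 0) *
      truncExp c α n (j + y 0) (t - x 0) (fun k => x (k + 1)) (fun k => y (k + 1)) := by
  rw [truncExp, if_pos hj]; rfl

theorem truncExp_of_not (c α : ℝ) (n : ℕ) {j : ZMod 4} (hj : ¬(j = 0 ∨ j = 1)) (t : ℝ)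
    (x : ℕ → ℝ) (y : ℕ → ZMod 4) : truncExp c α n j t x y = 0 := by
  cases n with
  | zero => rfl
  | succ n => rw [truncExp, if_neg hj]

theorem integral_expMeasure_ite {lam : ℝ} (hlam : 0 < lam) {t : ℝ} (ht : 0 ≤ t) (K : ℂ)
    {g : ℝ → ℂ} (hg : Continuous g) :
    ∫ u, (if t ≤ u then K else g u) ∂(expMeasure lam) =
      Complex.exp (-(lam : ℂ) * t) * K +
        ∫ u in (0 : ℝ)..t, (lam : ℂ) * Complex.exp (-(lam : ℂ) * u) * g u := by
  have h1 : ∫ u, (if t ≤ u then K else g u) ∂(expMeasure lam) =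
      ∫ u, (exponentialPDF lam u).toReal • (if t ≤ u then K else g u) := by
    have hm : Measurable (exponentialPDF lam) :=
      (measurable_exponentialPDFReal lam).ennreal_ofReal
    exact integral_withDensity_eq_integral_toReal_smul hm
      (ae_of_all _ fun u => ENNReal.ofReal_lt_top) _
  have h2 : (fun u => (exponentialPDF lam u).toReal • (if t ≤ u then K else g u)) =ᵐ[volume]
      fun u => (Set.Ioc 0 t).indicator
          (fun u : ℝ => (lam : ℂ) * Complex.exp (-(lam : ℂ) * u) * g u) u +
        (Set.Ioi t).indicator (fun u : ℝ => ((lam * Real.exp (-lam * u) : ℝ) : ℂ) * K) u := by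
    -- At `u = t` and `u = 0` the half-open intervals do not match the case distinctions on the
    -- left.
    filter_upwards [Measure.ae_ne volume t, Measure.ae_ne volume 0] with u hu hu0
    rw [exponentialPDF_eq]
    have hpos : 0 ≤ lam * Real.exp (-(lam * u)) := by positivity
    rcases lt_or_gt_of_ne hu0 with h | h
    · have h' : ¬ t < u := by linarith
      simp [not_le.2 h, not_lt.2 h.le, h']
    · rcases lt_or_gt_of_ne hu with h' | h'
      · simp [h, h.le, h'.le, not_le.2 h', not_lt.2 h'.le, ENNReal.toReal_ofReal hpos]
      · simp [h, h.le, h'.le, not_le.2 h', h', ENNReal.toReal_ofReal hpos]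
  have hc : Continuous fun u : ℝ => (lam : ℂ) * Complex.exp (-(lam : ℂ) * u) * g u := by fun_prop
  have hi : IntegrableOn (fun u : ℝ => ((lam * Real.exp (-lam * u) : ℝ) : ℂ) * K) (Set.Ioi t) :=
    (((exp_neg_integrableOn_Ioi t hlam).const_mul lam).ofReal).mul_const K
  rw [h1, integral_congr_ae h2, integral_add, integral_indicator measurableSet_Ioc,
    integral_indicator measurableSet_Ioi, ← intervalIntegral.integral_of_le ht, add_comm]
  · congr 1
    rw [integral_mul_const, integral_complex_ofReal, integral_const_mul,
      integral_exp_mul_Ioi (neg_lt_zero.2 hlam)]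
    congr 1
    push_cast
    have : (lam : ℂ) ≠ 0 := by exact_mod_cast hlam.ne'
    field_simp
  · exact (hc.integrableOn_Ioc).integrable_indicator measurableSet_Ioc
  · exact hi.integrable_indicator measurableSet_Ioi

/-- A system of functions that solves the renewal equations of the motion. -/
structure IsRenewalSolution (lam c p q α : ℝ) (f : ZMod 4 → ℝ → ℂ) : Prop where
  continuous : ∀ j, Continuous (f j)
  eq_integral : ∀ j, j = 0 ∨ j = 1 → ∀ t, 0 ≤ t → f j t =
    ∫ u, (if t ≤ u then phase c α j t else
      phase c α j u * (swapProb p q j * f (1 - j) (t - u))) ∂(expMeasure lam)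

theorem hasDerivAt_phase (c α : ℝ) (j : ZMod 4) (u : ℝ) :
    HasDerivAt (phase c α j)
      (Complex.I * α * c * ((unitX j - unitY j : ℝ) : ℂ) * phase c α j u) u := by
  have h : HasDerivAt (fun u : ℝ => Complex.I * ((α * (c * (unitX j - unitY j) * u) : ℝ) : ℂ))
      (Complex.I * ((α * (c * (unitX j - unitY j) * 1) : ℝ) : ℂ)) u :=
    ((((hasDerivAt_id u).const_mul (c * (unitX j - unitY j))).const_mul α).ofReal_comp).const_mul _
  refine h.cexp.congr_deriv ?_
  simp only [phase]; push_cast; ring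

/-- Variation of constants: the integrand is the derivative in `u` of `-e^{-λu} phase(u) f_j(t -
u)`. The boundary term at `u = 0` is `f_j(t)`; the one at `u = t` cancels the no-event term because
`f_j(0) = 1`. -/
theorem isRenewalSolution_of_hasDerivAt {lam : ℝ} (hlam : 0 < lam) (c p q α : ℝ)
    {f : ZMod 4 → ℝ → ℂ} (hf0 : ∀ j, f j 0 = 1) (hcont : ∀ j, Continuous (f j))
    (hf : ∀ j, j = 0 ∨ j = 1 → ∀ t, HasDerivAt (f j)
      ((-(lam : ℂ) + Complex.I * α * c * ((unitX j - unitY j : ℝ) : ℂ)) * f j t +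
        lam * swapProb p q j * f (1 - j) t) t) :
    IsRenewalSolution lam c p q α f where
  continuous := hcont
  eq_integral j hj t ht := by
    have hc := hcont (1 - j)
    rw [integral_expMeasure_ite hlam ht _ (by fun_prop)]
    have hd : ∀ u ∈ Set.uIcc 0 t, HasDerivAt
        (fun u : ℝ => -(Complex.exp (-(lam : ℂ) * u) * phase c α j u * f j (t - u)))
        ((lam : ℂ) * Complex.exp (-(lam : ℂ) * u) *
          (phase c α j u * (swapProb p q j * f (1 - j) (t - u)))) u := by
      intro u _
      have h1 : HasDerivAt (fun u : ℝ => Complex.exp (-(lam : ℂ) * u))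
          (Complex.exp (-(lam : ℂ) * u) * (-(lam : ℂ) * 1)) u :=
        ((hasDerivAt_id u).ofReal_comp.const_mul (-(lam : ℂ))).cexp
      have h2 := (hf j hj (t - u)).comp_const_sub t u
      refine ((h1.mul (hasDerivAt_phase c α j u)).mul h2).neg.congr_deriv ?_
      simp only [Pi.mul_apply]
      ring
    rw [intervalIntegral.integral_eq_sub_of_hasDerivAt hd
      (Continuous.intervalIntegrable (by fun_prop) _ _)]
    simp [hf0, phase]

section Renewal

variable {Ω : Type*} [MeasurableSpace Ω] {μ : Measure Ω} [IsProbabilityMeasure μ] {lam p q : ℝ}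
  {τ : ℕ → Ω → ℝ} {ξ : ℕ → Ω → ZMod 4}

theorem measurable_integral_truncExp (hτ : ∀ n, Measurable (τ n)) (hξ : ∀ n, Measurable (ξ n))
    (c α : ℝ) (n : ℕ) (j : ZMod 4) :
    Measurable fun s => ∫ ω, truncExp c α n j s (fun k => τ k ω) (fun k => ξ k ω) ∂μ := by
  have h : Measurable fun z : ℝ × Ω =>
      truncExp c α n j z.1 (fun k => τ k z.2) (fun k => ξ k z.2) :=
    (measurable_truncExp c α n).comp
      (f := fun z : ℝ × Ω => (j, z.1, (fun k => τ k z.2), fun k => ξ k z.2)) (by fun_prop)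
  exact (h.stronglyMeasurable.integral_prod_right (ν := μ)).measurable

theorem norm_integral_truncExp_le (c α : ℝ) (n : ℕ) (j : ZMod 4) (s : ℝ) :
    ‖∫ ω, truncExp c α n j s (fun k => τ k ω) (fun k => ξ k ω) ∂μ‖ ≤ 1 := by
  simpa using norm_integral_le_of_norm_le_const (μ := μ)
    (ae_of_all _ fun ω => norm_truncExp_le c α n j s (fun k => τ k ω) (fun k => ξ k ω))

namespace IsNoise

/-- Only one turn of positive probability stays inside `{0, 1}`: `1` from label `0`, and `-1 = 3`
from label `1`. -/
theorem integral_truncExp_turn (h : IsNoise μ lam p q τ ξ) (hp : 0 ≤ p) (hq : 0 ≤ q)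
    (hpq : p + q ≤ 1) (c α : ℝ) (n : ℕ) {j : ZMod 4} (hj : j = 0 ∨ j = 1) (s : ℝ) :
    ∫ ω, truncExp c α n (j + ξ 0 ω) s (fun k => τ (k + 1) ω) (fun k => ξ (k + 1) ω) ∂μ =
      swapProb p q j *
        ∫ ω, truncExp c α n (1 - j) s (fun k => τ (k + 1) ω) (fun k => ξ (k + 1) ω) ∂μ := by
  have hτ := h.measurable_wait
  have hξ := h.measurable_turn
  have hadd : Measurable fun z : ZMod 4 × (ℕ → ℝ) × (ℕ → ZMod 4) => j + z.1 :=
    (measurable_from_top (f := fun v : ZMod 4 => j + v)).comp measurable_fst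
  have hG : Measurable fun z : ZMod 4 × (ℕ → ℝ) × (ℕ → ZMod 4) =>
      truncExp c α n (j + z.1) s z.2.1 z.2.2 :=
    (measurable_truncExp c α n).comp
      (f := fun z : ZMod 4 × (ℕ → ℝ) × (ℕ → ZMod 4) => (j + z.1, s, z.2))
      (hadd.prodMk (by fun_prop))
  have e := integral_comp_of_indepFun_fintype (hξ 0) (by fun_prop) h.indep_zero_turn hG
    (fun z => norm_truncExp_le ..)
  simp only at e
  rw [e]
  have h4 := Fin.sum_univ_four (fun a : ZMod 4 => μ.real {ω | ξ 0 ω = a} •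
    ∫ ω, truncExp c α n (j + a) s (fun k => τ (k + 1) ω) (fun k => ξ (k + 1) ω) ∂μ)
  refine h4.trans ?_
  have h0 : μ.real {ω | ξ 0 ω = 0} = 0 := h.prob_zero_turn_eq_zero hp hq hpq
  have h1 : μ.real {ω | ξ 0 ω = 1} = p := by
    rw [Measure.real, h.prob_ccw, ENNReal.toReal_ofReal hp]
  have h3 : μ.real {ω | ξ 0 ω = 3} = q := by
    rw [show (3 : ZMod 4) = -1 by decide, Measure.real, h.prob_cw, ENNReal.toReal_ofReal hq]
  change μ.real {ω | ξ 0 ω = (0 : ZMod 4)} • _ + μ.real {ω | ξ 0 ω = (1 : ZMod 4)} •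
      (∫ ω, truncExp c α n (j + (1 : ZMod 4)) s _ _ ∂μ) + _ •
      (∫ ω, truncExp c α n (j + (2 : ZMod 4)) s _ _ ∂μ) + μ.real {ω | ξ 0 ω = (3 : ZMod 4)} •
      (∫ ω, truncExp c α n (j + (3 : ZMod 4)) s _ _ ∂μ) = _
  rw [h0, h1, h3]
  rcases hj with rfl | rfl
  · simp [truncExp_of_not c α n (j := 2) (by decide), truncExp_of_not c α n (j := 3) (by decide),
      swapProb_zero]
  · rw [show (1 + 3 : ZMod 4) = 0 by decide, show (1 + 1 : ZMod 4) = 2 by decide,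
      show (1 + 2 : ZMod 4) = 3 by decide]
    simp [truncExp_of_not c α n (j := 2) (by decide), truncExp_of_not c α n (j := 3) (by decide),
      swapProb_one]

theorem integral_truncExp_succ (h : IsNoise μ lam p q τ ξ) (hp : 0 ≤ p) (hq : 0 ≤ q)
    (hpq : p + q ≤ 1) (c α : ℝ) (n : ℕ) {j : ZMod 4} (hj : j = 0 ∨ j = 1) (t : ℝ) :
    ∫ ω, truncExp c α (n + 1) j t (fun k => τ k ω) (fun k => ξ k ω) ∂μ =
      ∫ u, (if t ≤ u then phase c α j t else phase c α j u * (swapProb p q j *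
        ∫ ω, truncExp c α n (1 - j) (t - u) (fun k => τ (k + 1) ω) (fun k => ξ (k + 1) ω) ∂μ))
        ∂(expMeasure lam) := by
  have hτ := h.measurable_wait
  have hξ := h.measurable_turn
  have hadd : Measurable fun z : ℝ × ZMod 4 × (ℕ → ℝ) × (ℕ → ZMod 4) => j + z.2.1 :=
    (measurable_from_top (f := fun v : ZMod 4 => j + v)).comp (by fun_prop)
  have hG : Measurable fun z : ℝ × ZMod 4 × (ℕ → ℝ) × (ℕ → ZMod 4) =>
      if t ≤ z.1 then phase c α j t else phase c α j z.1 *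
        truncExp c α n (j + z.2.1) (t - z.1) z.2.2.1 z.2.2.2 := by
    refine Measurable.ite (measurableSet_le (by fun_prop) (by fun_prop)) measurable_const
      (Measurable.mul ((continuous_phase c α j).measurable.comp measurable_fst) ?_)
    exact (measurable_truncExp c α n).comp
      (f := fun z : ℝ × ZMod 4 × (ℕ → ℝ) × (ℕ → ZMod 4) => (j + z.2.1, t - z.1, z.2.2))
      (hadd.prodMk (by fun_prop))
  have e := integral_comp_of_indepFun (hτ 0) (by fun_prop) h.indep_zero_wait hG (C := 1) (by
    intro z
    split_ifs
    · exact (norm_phase ..).le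
    · rw [norm_mul, norm_phase, one_mul]; exact norm_truncExp_le ..)
  simp only at e
  simp only [truncExp_succ c α n hj]
  rw [e, h.law_wait 0]
  refine integral_congr_ae (ae_of_all _ fun u => ?_)
  simp only
  split_ifs
  · simp
  · rw [integral_const_mul, h.integral_truncExp_turn hp hq hpq c α n hj]

end IsNoise

theorem ae_nonneg_expMeasure {lam : ℝ} (hlam : 0 < lam) : ∀ᵐ u ∂(expMeasure lam), 0 ≤ u := by
  have := isProbabilityMeasure_expMeasure hlam
  have h := cdf_expMeasure_eq hlam 0
  simp only [le_refl, if_true, mul_zero, neg_zero, Real.exp_zero, sub_self] at h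
  rw [cdf_eq_real, measureReal_eq_zero_iff] at h
  rw [ae_iff]
  exact measure_mono_null (fun u hu => (not_le.1 hu).le) h

theorem norm_swapProb_le (hp : 0 ≤ p) (hq : 0 ≤ q) (hpq : p + q ≤ 1) (j : ZMod 4) :
    ‖(swapProb p q j : ℂ)‖ ≤ 1 := by
  rw [Complex.norm_real, Real.norm_eq_abs, abs_le]
  unfold swapProb
  split_ifs <;> constructor <;> linarith

/-- Both terms obey the same renewal recursion, so the phase and no-event terms drop out. Each step
contributes a factor equal to the probability that a waiting time is at most `T`, since the
remaining time stays in `[0, T]`. -/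
theorem IsNoise.norm_integral_truncExp_sub_le (h : IsNoise μ lam p q τ ξ) (hlam : 0 < lam)
    (hp : 0 ≤ p) (hq : 0 ≤ q) (hpq : p + q ≤ 1) {c α : ℝ} {f : ZMod 4 → ℝ → ℂ}
    (hf : IsRenewalSolution lam c p q α f) {T C : ℝ}
    (hC : ∀ j, ∀ t ∈ Set.Icc 0 T, ‖f j t‖ ≤ C) (n : ℕ) {j : ZMod 4} (hj : j = 0 ∨ j = 1) {t : ℝ}
    (ht : t ∈ Set.Icc 0 T) :
    ‖∫ ω, truncExp c α n j t (fun k => τ k ω) (fun k => ξ k ω) ∂μ - f j t‖ ≤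
      C * (expMeasure lam).real (Set.Iic T) ^ n := by
  have hP := isProbabilityMeasure_expMeasure hlam
  induction n generalizing j t τ ξ with
  | zero => simpa [truncExp] using hC j t ht
  | succ n ih =>
    set r := (expMeasure lam).real (Set.Iic T) with hr
    have hC0 : 0 ≤ C := (norm_nonneg _).trans (hC j t ht)
    have hj' : 1 - j = 0 ∨ 1 - j = 1 := by rcases hj with rfl | rfl <;> decide
    have hw := norm_swapProb_le hp hq hpq j
    rw [h.integral_truncExp_succ hp hq hpq c α n hj, hf.eq_integral j hj t ht.1,
      ← integral_sub]
    · have hle : ∀ᵐ u ∂(expMeasure lam), ‖(if t ≤ u then phase c α j t else phase c α j u *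
          (swapProb p q j * ∫ ω, truncExp c α n (1 - j) (t - u) (fun k => τ (k + 1) ω)
            (fun k => ξ (k + 1) ω) ∂μ)) - (if t ≤ u then phase c α j t else
          phase c α j u * (swapProb p q j * f (1 - j) (t - u)))‖ ≤
          (Set.Iic T).indicator (fun _ => C * r ^ n) u := by
        -- For `u < 0` the remaining time `t - u` could exceed `T`, beyond the reach of the
        -- induction hypothesis.
        filter_upwards [ae_nonneg_expMeasure hlam] with u hu
        split_ifs with htu
        · rw [sub_self, norm_zero]
          exact Set.indicator_nonneg (fun _ _ => by positivity) _
        · have huT : u ∈ Set.Iic T := (not_le.1 htu).le.trans ht.2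
          rw [Set.indicator_of_mem huT, ← mul_sub, ← mul_sub, norm_mul, norm_mul, norm_phase,
            one_mul]
          refine (mul_le_of_le_one_left (norm_nonneg _) hw).trans ?_
          exact ih h.shift hj' ⟨by linarith [not_le.1 htu], by linarith [ht.2]⟩
      refine (norm_integral_le_of_norm_le
        ((integrable_const _).indicator measurableSet_Iic) hle).trans_eq ?_
      rw [integral_indicator_const _ measurableSet_Iic, smul_eq_mul, ← hr]
      ring
    · refine Integrable.of_bound (C := 1) (Measurable.aestronglyMeasurable ?_)
        (ae_of_all _ fun u => ?_)
      · refine Measurable.ite (measurableSet_le (by fun_prop) (by fun_prop)) measurable_const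
          ((continuous_phase c α j).measurable.mul (measurable_const.mul ?_))
        exact (measurable_integral_truncExp h.shift.measurable_wait h.shift.measurable_turn
          c α n (1 - j)).comp (by fun_prop)
      · split_ifs
        · exact (norm_phase ..).le
        · rw [norm_mul, norm_mul, norm_phase, one_mul]
          exact mul_le_one₀ hw (norm_nonneg _) (norm_integral_truncExp_le ..)
    · refine Integrable.of_bound (C := max 1 C) (Measurable.aestronglyMeasurable ?_) ?_
      · refine Measurable.ite (measurableSet_le (by fun_prop) (by fun_prop)) measurable_const
          (Continuous.measurable ?_)
        have := hf.continuous (1 - j)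
        fun_prop
      · filter_upwards [ae_nonneg_expMeasure hlam] with u hu
        split_ifs with htu
        · exact (norm_phase ..).le.trans (le_max_left _ _)
        · rw [norm_mul, norm_mul, norm_phase, one_mul]
          refine (mul_le_of_le_one_left (norm_nonneg _) hw).trans ?_
          exact (hC _ _ ⟨by linarith [not_le.1 htu], by linarith [ht.2]⟩).trans (le_max_right _ _)

theorem IsNoise.tendsto_integral_truncExp (h : IsNoise μ lam p q τ ξ) (hlam : 0 < lam)
    (hp : 0 ≤ p) (hq : 0 ≤ q) (hpq : p + q ≤ 1) {c α : ℝ} {f : ZMod 4 → ℝ → ℂ}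
    (hf : IsRenewalSolution lam c p q α f) {j : ZMod 4} (hj : j = 0 ∨ j = 1) {t : ℝ}
    (ht : 0 ≤ t) :
    Tendsto (fun n => ∫ ω, truncExp c α n j t (fun k => τ k ω) (fun k => ξ k ω) ∂μ) atTop
      (𝓝 (f j t)) := by
  have hP := isProbabilityMeasure_expMeasure hlam
  have hbdd : ∀ j, ∃ C, ∀ s ∈ Set.Icc 0 t, ‖f j s‖ ≤ C := fun j =>
    isCompact_Icc.exists_bound_of_continuousOn (hf.continuous j).continuousOn
  choose C hC using hbdd
  obtain ⟨M, hM⟩ := (Set.finite_range C).bddAbove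
  have hr : (expMeasure lam).real (Set.Iic t) < 1 := by
    rw [← cdf_eq_real, cdf_expMeasure_eq hlam, if_pos ht]
    linarith [Real.exp_pos (-(lam * t))]
  rw [tendsto_iff_norm_sub_tendsto_zero]
  refine squeeze_zero (fun _ => norm_nonneg _) (fun n => h.norm_integral_truncExp_sub_le hlam hp hq
    hpq hf (T := t) (C := M) (fun j s hs => (hC j s hs).trans (hM ⟨j, rfl⟩)) n hj ⟨ht, le_rfl⟩) ?_
  simpa using (tendsto_pow_atTop_nhds_zero_of_lt_one measureReal_nonneg hr).const_mul M

end Renewal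

/-! ### Passing to the limit and solving the linear system. -/

section Expectation

variable {Ω : Type*} [MeasurableSpace Ω] {μ : Measure Ω}
  {lam c p q : ℝ} {D₀ : Ω → ZMod 4} {τ : ℕ → Ω → ℝ} {ξ : ℕ → Ω → ZMod 4}

namespace IsMotionData

theorem measurable_truncExp_path (h : IsMotionData μ lam p q D₀ τ ξ) (c α : ℝ) (n : ℕ) (t : ℝ) :
    Measurable fun ω => truncExp c α n (D₀ ω) t (fun k => τ k ω) (fun k => ξ k ω) := by
  have hτ := h.measurable_wait
  have hξ := h.measurable_turn
  have hD := h.measurable_init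
  exact (measurable_truncExp c α n).comp
    (f := fun ω => (D₀ ω, t, (fun k => τ k ω), fun k => ξ k ω)) (by fun_prop)

variable [IsProbabilityMeasure μ]

theorem ae_tendsto_truncExp (h : IsMotionData μ lam p q D₀ τ ξ) (hlam : 0 < lam) (hc : 0 < c)
    (α : ℝ) {t : ℝ} (ht : 0 < t) :
    ∀ᵐ ω ∂μ, Tendsto (fun n => truncExp c α n (D₀ ω) t (fun k => τ k ω) (fun k => ξ k ω)) atTop
      (𝓝 (sideExp c D₀ τ ξ α t ω)) := by
  filter_upwards [h.isNoise.ae_wait_pos hlam, h.isNoise.ae_tendsto_arrivalTime hlam]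
    with ω hpos hlim
  refine tendsto_const_nhds.congr' ?_
  filter_upwards [hlim.eventually_ge_atTop t] with n hn
  exact sideExp_eq_truncExp hc α n ht hpos hlim hn

theorem integrable_sideExp (h : IsMotionData μ lam p q D₀ τ ξ) (hlam : 0 < lam) (hc : 0 < c)
    (α : ℝ) {t : ℝ} (ht : 0 < t) : Integrable (sideExp c D₀ τ ξ α t) μ := by
  refine Integrable.of_bound (C := 1) (aestronglyMeasurable_of_tendsto_ae atTop
    (fun n => (h.measurable_truncExp_path c α n t).aestronglyMeasurable)
    (h.ae_tendsto_truncExp hlam hc α ht)) (ae_of_all _ fun ω => ?_)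
  rw [sideExp]
  refine (norm_indicator_le_norm_self _ _).trans ?_
  rw [mul_comm Complex.I, Complex.norm_exp_ofReal_mul_I]

theorem integral_truncExp_init (h : IsMotionData μ lam p q D₀ τ ξ) (c α : ℝ) (n : ℕ) (t : ℝ) :
    ∫ ω, truncExp c α n (D₀ ω) t (fun k => τ k ω) (fun k => ξ k ω) ∂μ =
      (1 / 4 : ℂ) * (∫ ω, truncExp c α n 0 t (fun k => τ k ω) (fun k => ξ k ω) ∂μ +
        ∫ ω, truncExp c α n 1 t (fun k => τ k ω) (fun k => ξ k ω) ∂μ) := by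
  have hτ := h.measurable_wait
  have hξ := h.measurable_turn
  have e := integral_comp_of_indepFun_fintype h.measurable_init (by fun_prop) h.indep_init
    (G := fun z => truncExp c α n z.1 t z.2.1 z.2.2)
    ((measurable_truncExp c α n).comp
      (f := fun z : ZMod 4 × (ℕ → ℝ) × (ℕ → ZMod 4) => (z.1, t, z.2)) (by fun_prop))
    (fun z => norm_truncExp_le ..)
  simp only at e
  have hD : ∀ a, μ.real {ω | D₀ ω = a} = 1 / 4 := fun a => by
    rw [Measure.real, h.prob_init]; simp
  simp only [hD] at e
  rw [e]
  refine (Fin.sum_univ_four (fun a : ZMod 4 => ((1 : ℝ) / 4) •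
    ∫ ω, truncExp c α n a t (fun k => τ k ω) (fun k => ξ k ω) ∂μ)).trans ?_
  change ((1 : ℝ) / 4) • (∫ ω, truncExp c α n (0 : ZMod 4) t _ _ ∂μ) +
    ((1 : ℝ) / 4) • (∫ ω, truncExp c α n (1 : ZMod 4) t _ _ ∂μ) +
    ((1 : ℝ) / 4) • (∫ ω, truncExp c α n (2 : ZMod 4) t _ _ ∂μ) +
    ((1 : ℝ) / 4) • (∫ ω, truncExp c α n (3 : ZMod 4) t _ _ ∂μ) = _
  simp only [truncExp_of_not c α n (j := 2) (by decide), truncExp_of_not c α n (j := 3) (by decide),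
    Complex.real_smul]
  push_cast
  simp only [integral_zero]
  ring

/-- The truncated expectations have two limits, one by dominated convergence and one from the
renewal equations; these must coincide. -/
theorem integral_sideExp_of_isRenewalSolution (h : IsMotionData μ lam p q D₀ τ ξ) (hlam : 0 < lam)
    (hc : 0 < c) (hp : 0 ≤ p) (hq : 0 ≤ q) (hpq : p + q ≤ 1) {α : ℝ} {f : ZMod 4 → ℝ → ℂ}
    (hf : IsRenewalSolution lam c p q α f) {t : ℝ} (ht : 0 < t) :
    ∫ ω, sideExp c D₀ τ ξ α t ω ∂μ = (1 / 4 : ℂ) * (f 0 t + f 1 t) := by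
  have h1 := tendsto_integral_of_dominated_convergence (μ := μ) (fun _ => 1)
    (fun n => (h.measurable_truncExp_path c α n t).aestronglyMeasurable) (integrable_const 1)
    (fun n => ae_of_all _ fun ω => norm_truncExp_le ..) (h.ae_tendsto_truncExp hlam hc α ht)
  simp only [h.integral_truncExp_init] at h1
  have h2 := fun j hj => h.isNoise.tendsto_integral_truncExp hlam hp hq hpq hf (j := j) hj ht.le
  exact tendsto_nhds_unique h1 (((h2 0 (by simp)).add (h2 1 (by simp))).const_mul _)

/-- The expectation of `sideExp` in terms of a solution of `A'' = (λ²pq - α²c²) A` with `A(0) = 1`,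
`A'(0) = 0` and of its primitive `B` with `B(0) = 0`. -/
theorem integral_sideExp_eq (h : IsMotionData μ lam p q D₀ τ ξ) (hlam : 0 < lam)
    (hc : 0 < c) (hp : 0 ≤ p) (hq : 0 ≤ q) (hpq : p + q ≤ 1) (α : ℝ) {A B : ℝ → ℂ}
    (hA : ∀ t, HasDerivAt A (((lam ^ 2 * p * q - α ^ 2 * c ^ 2 : ℝ) : ℂ) * B t) t)
    (hB : ∀ t, HasDerivAt B (A t) t) (hA0 : A 0 = 1) (hB0 : B 0 = 0) {t : ℝ} (ht : 0 < t) :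
    ∫ ω, sideExp c D₀ τ ξ α t ω ∂μ =
      Complex.exp (-(lam : ℂ) * t) / 4 * (2 * A t + lam * (p + q) * B t) := by
  -- This is `e^{-λt}(A I + B M)` applied to `(1, 1)`: the factor of `B t` is the sum of row `j` of
  -- `M`, for `j = 0, 1`.
  let f : ZMod 4 → ℝ → ℂ := fun j t => Complex.exp (-(lam : ℂ) * t) *
    (A t + B t * (Complex.I * α * c * ((unitX j - unitY j : ℝ) : ℂ) + lam * swapProb p q j))
  have hd : ∀ j t, HasDerivAt (f j) (-(lam : ℂ) * f j t + Complex.exp (-(lam : ℂ) * t) *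
      (((lam ^ 2 * p * q - α ^ 2 * c ^ 2 : ℝ) : ℂ) * B t + A t *
        (Complex.I * α * c * ((unitX j - unitY j : ℝ) : ℂ) + lam * swapProb p q j))) t := by
    intro j t
    have h1 : HasDerivAt (fun u : ℝ => Complex.exp (-(lam : ℂ) * u))
        (Complex.exp (-(lam : ℂ) * t) * (-(lam : ℂ) * 1)) t :=
      ((hasDerivAt_id t).ofReal_comp.const_mul (-(lam : ℂ))).cexp
    refine (h1.mul ((hA t).add ((hB t).mul_const
      (Complex.I * α * c * ((unitX j - unitY j : ℝ) : ℂ) + lam * swapProb p q j)))).congr_deriv ?_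
    simp only [f, Pi.add_apply]; ring
  have hf : IsRenewalSolution lam c p q α f := by
    refine isRenewalSolution_of_hasDerivAt hlam c p q α (fun j => by simp [f, hA0, hB0])
      (fun j => continuous_iff_continuousAt.2 fun t => (hd j t).continuousAt) fun j hj t => ?_
    convert hd j t using 1
    simp only [f]
    have hI := Complex.I_sq
    rcases hj with rfl | rfl
    · simp only [sub_zero, unitX_zero, unitY_zero, unitX_one, unitY_one, swapProb_zero, swapProb_one]
      push_cast
      linear_combination Complex.exp (-(lam : ℂ) * t) * B t * α ^ 2 * c ^ 2 * hI
    · simp only [sub_self, unitX_zero, unitY_zero, unitX_one, unitY_one, swapProb_zero, swapProb_one]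
      push_cast
      linear_combination Complex.exp (-(lam : ℂ) * t) * B t * α ^ 2 * c ^ 2 * hI
  rw [h.integral_sideExp_of_isRenewalSolution hlam hc hp hq hpq hf ht]
  simp only [f, unitX_zero, unitY_zero, unitX_one, unitY_one, swapProb_zero, swapProb_one]
  push_cast
  ring

end IsMotionData

end Expectation

theorem mainTheorem5 {Ω : Type*} [MeasurableSpace Ω] (μ : Measure Ω) [IsProbabilityMeasure μ]
    (lam c p q : ℝ) (hlam : 0 < lam) (hc : 0 < c) (hp : 0 ≤ p) (hq : 0 ≤ q) (hpq : p + q ≤ 1)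
    (D₀ : Ω → ZMod 4) (τ : ℕ → Ω → ℝ) (ξ : ℕ → Ω → ZMod 4)
    (hmotion : IsMotionData μ lam p q D₀ τ ξ) (α t : ℝ) (ht : 0 < t) :
    Integrable (sideExp c D₀ τ ξ α t) μ ∧
    (∀ s : ℂ, s ^ 2 = ((lam ^ 2 * p * q - α ^ 2 * c ^ 2 : ℝ) : ℂ) → s ≠ 0 →
      ∫ ω, sideExp c D₀ τ ξ α t ω ∂μ =
        Complex.exp (-(lam : ℂ) * (t : ℂ)) / 4 *
          ((1 + (lam : ℂ) * ((p : ℂ) + (q : ℂ)) / (2 * s)) * Complex.exp ((t : ℂ) * s) +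
            (1 - (lam : ℂ) * ((p : ℂ) + (q : ℂ)) / (2 * s)) * Complex.exp (-((t : ℂ) * s)))) ∧
    (lam ^ 2 * p * q - α ^ 2 * c ^ 2 = 0 →
      ∫ ω, sideExp c D₀ τ ξ α t ω ∂μ =
        Complex.exp (-(lam : ℂ) * (t : ℂ)) / 4 *
          (2 + (lam : ℂ) * ((p : ℂ) + (q : ℂ)) * (t : ℂ))) := by
  refine ⟨hmotion.integrable_sideExp hlam hc α ht, fun s hs hs0 => ?_, fun h0 => ?_⟩
  · have h1 : ∀ u : ℝ, HasDerivAt (fun u : ℝ => Complex.exp ((u : ℂ) * s))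
        (Complex.exp ((u : ℂ) * s) * (1 * s)) u := fun u =>
      ((hasDerivAt_id u).ofReal_comp.mul_const s).cexp
    have h2 : ∀ u : ℝ, HasDerivAt (fun u : ℝ => Complex.exp (-((u : ℂ) * s)))
        (Complex.exp (-((u : ℂ) * s)) * (-(1 * s))) u := fun u =>
      ((hasDerivAt_id u).ofReal_comp.mul_const s).neg.cexp
    -- Here `A = cosh (us)` and `B = sinh (us) / s`.
    rw [hmotion.integral_sideExp_eq hlam hc hp hq hpq α
      (A := fun u => (Complex.exp ((u : ℂ) * s) + Complex.exp (-((u : ℂ) * s))) / 2)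
      (B := fun u => (Complex.exp ((u : ℂ) * s) - Complex.exp (-((u : ℂ) * s))) / (2 * s))
      (fun u => ?_) (fun u => ?_) (by simp) (by simp) ht]
    · field_simp
      ring
    · rw [← hs]
      refine (((h1 u).add (h2 u)).div_const 2).congr_deriv ?_
      field_simp
      ring
    · refine (((h1 u).sub (h2 u)).div_const (2 * s)).congr_deriv ?_
      field_simp
      ring
  -- The limits of `cosh (us)` and `sinh (us) / s` as `s → 0`.
  · rw [hmotion.integral_sideExp_eq hlam hc hp hq hpq α (A := fun _ => 1) (B := fun u => (u : ℂ))
      (fun u => ?_) (fun u => (hasDerivAt_id u).ofReal_comp) rfl (by simp) ht]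
    · ring
    · rw [h0]
      simpa using hasDerivAt_const u (1 : ℂ)
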